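/- Let $e\ge 2$ and $r\ge 2$ be integers, and let $B^{\oplus}(e,e,r)$ be the monoid generated by $t_i$ ($i\in\mathbb{Z}/e$) and $s_3,\dots,s_r$ subject to the relations $s_is_js_i=s_js_is_j$ for $|i-j|=1$; $s_is_j=s_js_i$ for $|i-j|>1$; $s_3t_is_3=t_is_3t_i$ for $i\in\mathbb{Z}/e$; $s_jt_i=t_is_j$ for $i\in\mathbb{Z}/e$ and $4\le j\le r$; and $t_it_{i-1}=t_jt_{j-1}$ for $i,j\in\mathbb{Z}/e$. Let $\tau=t_it_{i-1}$ (which does not depend on $i$), let $\Lambda_2=\tau$ and $\Lambda_k=s_k\cdots s_3\,\tau\,s_3\cdots s_k$ for $3\le k\le r$, and let $\Delta=\Lambda_2\Lambda_3\cdots\Lambda_r$. A Garside element of a monoid is an element whose left divisors and right divisors coincide, are finite in number and generate the monoid; the simples of a monoid are the divisors of its minimal Garside element, that is, of the Garside element that left-divides every Garside element. Then $\Delta$ is the minimal Garside element of $B^{\oplus}(e,e,r)$, and the simples of $B^{\oplus}(e,e,r)$, i.e. the divisors of $\Delta$, are precisely the elements of the form $p_2p_3\cdots p_r$ where $p_k$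 is a left divisor of $\Lambda_k$ for each $2\le k\le r$. -/

import Mathlib

/-- The element `d` of a monoid is a Garside element: its left divisors and its right divisors
coincide, are finite in number and generate the monoid. In Mathlib `x ∣ d` means
`∃ z, d = x * z`, that is, `x` is a left divisor of `d`. -/
def IsGarsideElement {M : Type*} [Monoid M] (d : M) : Prop :=
  (∀ x : M, x ∣ d ↔ ∃ z : M, d = z * x) ∧
    {x : M | x ∣ d}.Finite ∧ Submonoid.closure {x : M | x ∣ d} = ⊤

/-- The minimal Garside element: a Garside element that divides every Garside element. -/
def IsMinimalGarsideElement {M : Type*} [Monoid M] (d : M) : Prop :=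
  IsGarsideElement d ∧ ∀ d' : M, IsGarsideElement d' → d ∣ d'

/-- The simples of a monoid: the divisors of its minimal Garside element. -/
def IsSimpleElement {M : Type*} [Monoid M] (x : M) : Prop :=
  ∃ d : M, IsMinimalGarsideElement d ∧ x ∣ d

namespace BraidMonoid

/-- The generators `t_i` for `i ∈ ℤ/e`, and `s_j` for `3 ≤ j ≤ r`. -/
inductive Gen (e r : ℕ) : Type
  | t (i : ZMod e) : Gen e r
  | s (j : ℕ) (h : 3 ≤ j ∧ j ≤ r) : Gen e r

open FreeMonoid in
/-- The defining relations. Those between two generators `s_i`, `s_j` are listed for `i < j`;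
they are symmetric in `i` and `j`. -/
inductive Rel (e r : ℕ) : FreeMonoid (Gen e r) → FreeMonoid (Gen e r) → Prop
  | braid_ss (i j : ℕ) (hi : 3 ≤ i ∧ i ≤ r) (hj : 3 ≤ j ∧ j ≤ r) (hij : i + 1 = j) :
      Rel e r (of (.s i hi) * of (.s j hj) * of (.s i hi))
        (of (.s j hj) * of (.s i hi) * of (.s j hj))
  | comm_ss (i j : ℕ) (hi : 3 ≤ i ∧ i ≤ r) (hj : 3 ≤ j ∧ j ≤ r) (hij : i + 1 < j) :
      Rel e r (of (.s i hi) * of (.s j hj)) (of (.s j hj) * of (.s i hi))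
  | braid_st (h : 3 ≤ 3 ∧ 3 ≤ r) (i : ZMod e) :
      Rel e r (of (.s 3 h) * of (.t i) * of (.s 3 h)) (of (.t i) * of (.s 3 h) * of (.t i))
  | comm_st (j : ℕ) (hj : 3 ≤ j ∧ j ≤ r) (h4 : 4 ≤ j) (i : ZMod e) :
      Rel e r (of (.s j hj) * of (.t i)) (of (.t i) * of (.s j hj))
  | circle (i j : ZMod e) :
      Rel e r (of (.t i) * of (.t (i - 1))) (of (.t j) * of (.t (j - 1)))

end BraidMonoid

/-- The monoid `B⊕(e,e,r)`. -/
abbrev BraidMonoid (e r : ℕ) : Type := PresentedMonoid (BraidMonoid.Rel e r)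

namespace BraidMonoid

/-- The element `t_i`. -/
def t (e r : ℕ) (i : ZMod e) : BraidMonoid e r := PresentedMonoid.of (Rel e r) (.t i)

/-- The element `s_j` for `3 ≤ j ≤ r`; it is only used for these `j`. -/
def s (e r : ℕ) (j : ℕ) : BraidMonoid e r :=
  if h : 3 ≤ j ∧ j ≤ r then PresentedMonoid.of (Rel e r) (.s j h) else 1

/-- The element `τ = t_i t_{i-1}`, written with `i = 1`; see `tau_eq`. -/
def tau (e r : ℕ) : BraidMonoid e r := t e r 1 * t e r (1 - 1)

theorem tau_eq (e r : ℕ) (i : ZMod e) : tau e r = t e r i * t e r (i - 1) :=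
  Quotient.sound (ConGen.Rel.of _ _ (Rel.circle 1 i))

/-- `Λ_2 = τ` and `Λ_k = s_k Λ_{k-1} s_k = s_k ⋯ s_3 τ s_3 ⋯ s_k` for `3 ≤ k ≤ r`; it is only used
for `2 ≤ k ≤ r`. -/
def Lam (e r : ℕ) : ℕ → BraidMonoid e r
  | 0 => tau e r
  | 1 => tau e r
  | 2 => tau e r
  | k + 3 => s e r (k + 3) * Lam e r (k + 2) * s e r (k + 3)

/-- The ordered product `p_2 p_3 ⋯ p_r`. -/
def orderedProd {e : ℕ} (r : ℕ) (p : ℕ → BraidMonoid e r) : BraidMonoid e r :=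
  ((List.range' 2 (r - 1)).map p).prod

/-- `Δ = Λ_2 Λ_3 ⋯ Λ_r`. -/
def Delta (e r : ℕ) : BraidMonoid e r := orderedProd r (Lam e r)

end BraidMonoid

/-! Proof idea. Every relation between two distinct generators `a`, `b` presents one common right
multiple of them. The reduction argument of Brieskorn and Saito, an induction on the length of
words, shows that it is the least one and that the monoid is left cancellative. Hence generators
can be moved through products without losing information on divisibility. The element `Λ_k`
conjugates the submonoid of the generators before `s_k` by the shift `t_i ↦ t_{i+1}`, so that `Δ`
is quasi-central, which gives right cancellation, and the generators divide `Δ` on both sides. A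
generator that divides `q u`, where `q` is a right divisor of `Λ_k` and `u` involves only
generators before `s_k`, either divides `q` or slides through `q` to a divisor of `u`; collecting
generators in this way splits a divisor of `Δ` into divisors of the `Λ_k`. Finally, a common
multiple of all generators is divisible by `Λ_2`, then by `Λ_2 Λ_3`, and so on up to `Δ`. -/

/-! ### Presentations by length-preserving relations -/

/-- A presentation is homogeneous if the two sides of each relation have the same length, so that
the presented monoid is graded by word length. -/
class LengthPreserving {α : Type*} (rels : FreeMonoid α → FreeMonoid α → Prop) : Prop where
  length_eq : ∀ {x y : FreeMonoid α}, rels x y → x.length = y.length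

namespace LengthPreserving

open PresentedMonoid (of lift closure_range_of surjective_mk mk_eq_mk_iff)

variable {α : Type*} {rels : FreeMonoid α → FreeMonoid α → Prop}

theorem induction_left {p : PresentedMonoid rels → Prop} (x : PresentedMonoid rels) (one : p 1)
    (of_mul : ∀ a x, p x → p (of rels a * x)) : p x :=
  Submonoid.induction_of_closure_eq_top_left (closure_range_of rels) x one
    (by rintro _ ⟨a, rfl⟩ y hy; exact of_mul a y hy)

theorem induction_right {p : PresentedMonoid rels → Prop} (x : PresentedMonoid rels) (one : p 1)
    (mul_of : ∀ x a, p x → p (x * of rels a)) : p x :=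
  Submonoid.induction_of_closure_eq_top_right (closure_range_of rels) x one
    (by rintro y _ ⟨a, rfl⟩ hy; exact mul_of y a hy)

theorem lift_ofAdd_one (x : FreeMonoid α) :
    FreeMonoid.lift (fun _ => Multiplicative.ofAdd 1) x = Multiplicative.ofAdd x.length := by
  simp [FreeMonoid.lift_apply, FreeMonoid.length, ← ofAdd_nsmul]

variable [LengthPreserving rels]

/-- The word length of an element of the presented monoid. -/
def len (x : PresentedMonoid rels) : ℕ :=
  (lift (rels := rels) (fun _ => Multiplicative.ofAdd 1)
    (fun _ _ h => by rw [lift_ofAdd_one, lift_ofAdd_one, length_eq h]) x).toAdd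

@[simp] theorem len_one : len (1 : PresentedMonoid rels) = 0 := by simp [len]

@[simp] theorem len_mul (x y : PresentedMonoid rels) : len (x * y) = len x + len y := by simp [len]

@[simp] theorem len_of (a : α) : len (of rels a) = 1 := rfl

@[simp] theorem len_mk (x : FreeMonoid α) : len (PresentedMonoid.mk rels x) = x.length :=
  congrArg Multiplicative.toAdd (lift_ofAdd_one x)

theorem length_eq_of_conGen {x y : FreeMonoid α} (h : conGen rels x y) : x.length = y.length := by
  rw [← len_mk (rels := rels), mk_eq_mk_iff.2 h, len_mk]

theorem length_eq_of_conGen_of_mul {a b : α} {u v : FreeMonoid α}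
    (h : conGen rels (FreeMonoid.of a * u) (FreeMonoid.of b * v)) : u.length = v.length := by
  simpa only [FreeMonoid.length_mul, FreeMonoid.length_of, add_right_inj] using
    length_eq_of_conGen h

theorem eq_one_of_len_eq_zero {x : PresentedMonoid rels} (h : len x = 0) : x = 1 := by
  obtain ⟨w, rfl⟩ := surjective_mk x
  rw [len_mk, FreeMonoid.length_eq_zero] at h
  rw [h, map_one]

theorem eq_one_or_eq_one_of_mul_eq_of {x y : PresentedMonoid rels} {a : α}
    (h : x * y = of rels a) : x = 1 ∨ y = 1 := by
  have hlen := congrArg len h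
  rw [len_mul, len_of] at hlen
  rcases Nat.add_eq_one_iff.1 hlen with ⟨hx, -⟩ | ⟨-, hy⟩
  · exact .inl (eq_one_of_len_eq_zero hx)
  · exact .inr (eq_one_of_len_eq_zero hy)

theorem finite_dvd [Finite α] (d : PresentedMonoid rels) : {x | x ∣ d}.Finite := by
  refine ((List.finite_length_le α (len d)).image (PresentedMonoid.mk rels)).subset fun x hx => ?_
  obtain ⟨w, rfl⟩ := surjective_mk x
  obtain ⟨z, rfl⟩ := hx
  have hw : w.length ≤ len (PresentedMonoid.mk rels w * z) := by
    rw [len_mul, len_mk]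
    exact Nat.le_add_right _ _
  exact ⟨w, hw, rfl⟩

theorem of_mem_of_closure_eq_top {S : Set (PresentedMonoid rels)} (hS : Submonoid.closure S = ⊤)
    (a : α) : of rels a ∈ S := by
  by_contra ha
  have key : ∀ x : PresentedMonoid rels, x ≠ of rels a := fun x => by
    induction x using Submonoid.induction_of_closure_eq_top_left hS with
    | one => exact fun h => absurd (congrArg len h) (by simp)
    | mul_left x hx y ih =>
      intro h
      rcases eq_one_or_eq_one_of_mul_eq_of h with rfl | rfl
      · exact ih (by rwa [one_mul] at h)
      · rw [mul_one] at h
        exact ha (h ▸ hx)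
  exact key _ rfl

/-! ### The reduction lemma of Brieskorn and Saito -/

/-- Every equation `a u = b v` between letters `a`, `b`, with `u` of length less than `n`,
satisfies `F a u b v`. -/
def SolvedBelow (F : α → PresentedMonoid rels → α → PresentedMonoid rels → Prop) (n : ℕ) : Prop :=
  ∀ ⦃a b : α⦄ ⦃u v : PresentedMonoid rels⦄,
    of rels a * u = of rels b * v → len u < n → F a u b v

/-- A candidate description `F a u b v` of the solutions `u`, `v` of the equations `a u = b v`
between letters `a`, `b`. It contains the defining relations; transitivity through `c w` may use
that the equations shorter than `c w` are already solved by `F`. -/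
structure IsReductionRelation
    (F : α → PresentedMonoid rels → α → PresentedMonoid rels → Prop) : Prop where
  refl : ∀ a u, F a u a u
  symm : ∀ {a u b v}, F a u b v → F b v a u
  mul_right : ∀ {a u b v}, F a u b v → ∀ z, F a (u * z) b (v * z)
  of_rel : ∀ {x y}, rels x y → ∃ a u b v, x = FreeMonoid.of a * u ∧ y = FreeMonoid.of b * v ∧
    F a (PresentedMonoid.mk rels u) b (PresentedMonoid.mk rels v)
  trans_of_solvedBelow : ∀ {a u c w b v}, SolvedBelow F (len w) → F a u c w → F c w b v → F a u b v

theorem of_mul_inj {a b : α} {u v : FreeMonoid α}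
    (h : FreeMonoid.of a * u = FreeMonoid.of b * v) : a = b ∧ u = v :=
  List.cons.inj h

namespace IsReductionRelation

variable {F : α → PresentedMonoid rels → α → PresentedMonoid rels → Prop}

theorem exists_of_conGen (hF : IsReductionRelation F) {n : ℕ} (H : SolvedBelow F n)
    {x y : FreeMonoid α} (h : conGen rels x y) {a : α} {u : FreeMonoid α}
    (hx : x = FreeMonoid.of a * u) (hn : u.length ≤ n) :
    ∃ b v, y = FreeMonoid.of b * v ∧
      F a (PresentedMonoid.mk rels u) b (PresentedMonoid.mk rels v) := by
  induction h generalizing a u with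
  | of x y h =>
    obtain ⟨a', u', b, v, hx', hy, hf⟩ := hF.of_rel h
    obtain ⟨rfl, rfl⟩ := of_mul_inj (hx.symm.trans hx')
    exact ⟨b, v, hy, hf⟩
  | refl x => exact ⟨a, u, hx, hF.refl _ _⟩
  | @symm x y h ih =>
    subst hx
    cases x using FreeMonoid.casesOn with
    | one =>
      have hlen := length_eq_of_conGen h
      rw [FreeMonoid.length_one, FreeMonoid.length_mul, FreeMonoid.length_of] at hlen
      omega
    | of_mul b v =>
      obtain ⟨a', u', hy, hf⟩ := ih rfl ((length_eq_of_conGen_of_mul h).trans_le hn)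
      obtain ⟨rfl, rfl⟩ := of_mul_inj hy
      exact ⟨b, v, rfl, hF.symm hf⟩
  | @trans x y z h₁ h₂ ih₁ ih₂ =>
    subst hx
    obtain ⟨c, w, rfl, hf₁⟩ := ih₁ rfl hn
    have hw : w.length ≤ n := (length_eq_of_conGen_of_mul h₁).symm.trans_le hn
    obtain ⟨b, v, hz, hf₂⟩ := ih₂ rfl hw
    refine ⟨b, v, hz, hF.trans_of_solvedBelow (fun _ _ _ _ huv hu => H huv ?_) hf₁ hf₂⟩
    exact hu.trans_le ((len_mk w).trans_le hw)
  | @mul x x' y y' h₁ h₂ ih₁ ih₂ =>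
    have hlen := length_eq_of_conGen h₁
    cases x using FreeMonoid.casesOn with
    | one =>
      obtain rfl := FreeMonoid.length_eq_zero.1 hlen.symm
      simpa only [one_mul] using ih₂ (by simpa only [one_mul] using hx) hn
    | of_mul a' u' =>
      rw [mul_assoc] at hx
      obtain ⟨rfl, rfl⟩ := of_mul_inj hx
      rw [FreeMonoid.length_mul] at hn
      obtain ⟨b, v, rfl, hf⟩ := ih₁ rfl (by omega)
      refine ⟨b, v * y', mul_assoc _ _ _, ?_⟩
      rw [map_mul, map_mul, mk_eq_mk_iff.2 h₂]
      exact hF.mul_right hf _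

theorem solvedBelow (hF : IsReductionRelation F) (n : ℕ) : SolvedBelow F n := by
  induction n with
  | zero => exact fun _ _ _ _ _ h => absurd h (Nat.not_lt_zero _)
  | succ n ih =>
    intro a b u v h hu
    obtain ⟨u, rfl⟩ := surjective_mk u
    obtain ⟨v, rfl⟩ := surjective_mk v
    have hcon : conGen rels (FreeMonoid.of a * u) (FreeMonoid.of b * v) := mk_eq_mk_iff.1 h
    rw [len_mk] at hu
    obtain ⟨b', v', hv, hf⟩ := hF.exists_of_conGen ih hcon rfl (Nat.le_of_lt_succ hu)
    obtain ⟨rfl, rfl⟩ := of_mul_inj hv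
    exact hf

theorem of_mul_eq_of_mul (hF : IsReductionRelation F) {a b : α} {u v : PresentedMonoid rels}
    (h : of rels a * u = of rels b * v) : F a u b v :=
  hF.solvedBelow _ h (Nat.lt_succ_self _)

theorem isLeftCancelMul (hF : IsReductionRelation F) (eq_of : ∀ {a u v}, F a u a v → u = v) :
    IsLeftCancelMul (PresentedMonoid rels) where
  mul_left_cancel x u v h := by
    induction x using induction_left with
    | one => simpa only [one_mul] using h
    | of_mul a x ih =>
      simp only [mul_assoc] at h
      exact ih (eq_of (hF.of_mul_eq_of_mul h))

end IsReductionRelation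

end LengthPreserving

/-! ### Divisibility in cancellative monoids -/

section Monoid

variable {M : Type*} [Monoid M]

theorem mul_dvd_mul_left_cancel_iff [IsLeftCancelMul M] (a : M) {x u : M} :
    a * x ∣ a * u ↔ x ∣ u := by
  refine ⟨fun ⟨w, hw⟩ => ⟨w, ?_⟩, mul_dvd_mul_left a⟩
  rwa [mul_assoc, mul_right_inj] at hw

/-- The element `x * b = a * x` is a least common right multiple of `a` and `x`: multiplication by
`x` carries divisibility by `b` to divisibility by `a`, in both directions. -/
structure LcmSemiconjBy (x b a : M) : Prop where
  semiconjBy : SemiconjBy x b a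
  dvd_of_dvd_mul : ∀ {u}, a ∣ x * u → b ∣ u

namespace LcmSemiconjBy

variable {a a' b b' c x y : M}

theorem one_left (a : M) : LcmSemiconjBy 1 a a :=
  ⟨SemiconjBy.one_left a, fun h => by rwa [one_mul] at h⟩

theorem one_right (x : M) : LcmSemiconjBy x 1 1 :=
  ⟨SemiconjBy.one_right x, fun _ => one_dvd _⟩

theorem mul_left (hx : LcmSemiconjBy x b a) (hy : LcmSemiconjBy y c b) :
    LcmSemiconjBy (x * y) c a :=
  ⟨hx.semiconjBy.mul_left hy.semiconjBy,
    fun h => hy.dvd_of_dvd_mul (hx.dvd_of_dvd_mul (by rwa [mul_assoc] at h))⟩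

theorem mul_right [IsLeftCancelMul M] (h : LcmSemiconjBy x b a) (h' : LcmSemiconjBy x b' a') :
    LcmSemiconjBy x (b * b') (a * a') := by
  refine ⟨h.semiconjBy.mul_right h'.semiconjBy, fun {u} hu => ?_⟩
  obtain ⟨v, rfl⟩ := h.dvd_of_dvd_mul ((dvd_mul_right a a').trans hu)
  rw [← mul_assoc, h.semiconjBy.eq, mul_assoc, mul_dvd_mul_left_cancel_iff] at hu
  exact mul_dvd_mul_left b (h'.dvd_of_dvd_mul hu)

end LcmSemiconjBy

theorem isRightCancelMul_of_semiconjBy [IsLeftCancelMul M] {d : M} {S : Set M} (φ : M → M)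
    (hφ : Function.Surjective φ) (hd : ∀ x, SemiconjBy d x (φ x))
    (hS : Submonoid.closure S = ⊤) (hSd : ∀ a ∈ S, a ∣ d) : IsRightCancelMul M where
  mul_right_cancel a x y h := by
    induction a using Submonoid.induction_of_closure_eq_top_left hS generalizing x y with
    | one => simpa only [mul_one] using h
    | mul_left a ha z ih =>
      obtain ⟨w, hw⟩ := hSd a ha
      have hxy : x * d = y * d := by
        rw [hw, ← mul_assoc, ← mul_assoc, ih (x * a) (y * a) (by simpa only [mul_assoc] using h)]
      obtain ⟨x, rfl⟩ := hφ x
      obtain ⟨y, rfl⟩ := hφ y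
      rw [← (hd x).eq, ← (hd y).eq, mul_right_inj] at hxy
      rw [hxy]

theorem dvd_iff_exists_eq_mul_of_semiconjBy [IsCancelMul M] {d : M} (φ : M → M)
    (hφ : Function.Surjective φ) (hd : ∀ x, SemiconjBy d x (φ x)) (x : M) :
    x ∣ d ↔ ∃ z, d = z * x := by
  constructor
  · rintro ⟨y, hy⟩
    refine ⟨φ y, mul_right_cancel (b := y) ?_⟩
    rw [mul_assoc, ← hy, (hd y).eq]
  · rintro ⟨z, hz⟩
    obtain ⟨w, rfl⟩ := hφ z
    refine ⟨w, mul_left_cancel (a := φ w) ?_⟩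
    rw [← mul_assoc, ← hz, (hd w).eq]

theorem IsMinimalGarsideElement.isSimpleElement_iff {d : M} (hd : IsMinimalGarsideElement d)
    (x : M) : IsSimpleElement x ↔ x ∣ d :=
  ⟨fun ⟨_, hd', hx⟩ => hx.trans (hd'.2 d hd.1), fun hx => ⟨d, hd, hx⟩⟩

end Monoid

namespace BraidMonoid

open LengthPreserving

variable {e r : ℕ}

/-! ### Generators and their least common multiples -/

instance : LengthPreserving (Rel e r) where
  length_eq h := by cases h <;> rfl

/-- The position of a generator on the line `2 - 3 - ⋯ - r`, where every `t_i` is put at `2`. -/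
def Gen.pos : Gen e r → ℕ
  | .t _ => 2
  | .s j _ => j

/-- Sends `t_i` to `t_{i-1}` and fixes every `s_j`. -/
def Gen.pred : Gen e r → Gen e r
  | .t i => .t (i - 1)
  | .s j h => .s j h

@[simp] theorem Gen.pos_pred (a : Gen e r) : a.pred.pos = a.pos := by cases a <;> rfl

theorem Gen.two_le_pos (a : Gen e r) : 2 ≤ a.pos := by
  cases a with
  | t i => exact le_rfl
  | s j h => exact Nat.le_of_succ_le h.1

/-- The generators `a` and `b` are not neighbours on the line, so that they commute. -/
def Far (a b : Gen e r) : Prop := a.pos + 1 < b.pos ∨ b.pos + 1 < a.pos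

/-- The generators `a` and `b` are neighbours on the line, so that `a b a = b a b`. -/
def Adj (a b : Gen e r) : Prop := a.pos + 1 = b.pos ∨ b.pos + 1 = a.pos

theorem Far.symm {a b : Gen e r} (h : Far a b) : Far b a := Or.symm h

theorem Adj.symm {a b : Gen e r} (h : Adj a b) : Adj b a := Or.symm h

theorem Gen.eq_t_of_pos_eq {a b : Gen e r} (hne : a ≠ b) (h : a.pos = b.pos) :
    ∃ i j, i ≠ j ∧ a = .t i ∧ b = .t j := by
  cases a <;> cases b <;> simp_all [Gen.pos] <;> omega

theorem Gen.pred_ne_self {a b : Gen e r} (hne : a ≠ b) (h : a.pos = b.pos) : a.pred ≠ a := by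
  obtain ⟨i, j, hij, rfl, rfl⟩ := Gen.eq_t_of_pos_eq hne h
  have : Nontrivial (ZMod e) := ⟨i, j, hij⟩
  simp [Gen.pred]

theorem Gen.pred_ne_pred {a b : Gen e r} (hne : a ≠ b) (h : a.pos = b.pos) :
    a.pred ≠ b.pred := by
  obtain ⟨i, j, hij, rfl, rfl⟩ := Gen.eq_t_of_pos_eq hne h
  simpa [Gen.pred] using hij

/-- The element of the monoid given by a generator. -/
abbrev gen (a : Gen e r) : BraidMonoid e r := PresentedMonoid.of (Rel e r) a

theorem Far.commute {a b : Gen e r} (h : Far a b) : Commute (gen a) (gen b) := by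
  wlog hlt : a.pos + 1 < b.pos generalizing a b
  · exact (this h.symm (h.resolve_left hlt)).symm
  cases a with
  | t i =>
    cases b with
    | t j => simp [Gen.pos] at hlt
    | s j hj => exact (PresentedMonoid.mk_eq_mk_of_rel (Rel.comm_st j hj hlt i)).symm
  | s i hi =>
    cases b with
    | t j => simp only [Gen.pos] at hlt; omega
    | s j hj => exact PresentedMonoid.mk_eq_mk_of_rel (Rel.comm_ss i j hi hj hlt)

theorem Adj.braid {a b : Gen e r} (h : Adj a b) :
    gen a * (gen b * gen a) = gen b * (gen a * gen b) := by
  wlog hlt : a.pos + 1 = b.pos generalizing a b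
  · exact (this h.symm (h.resolve_left hlt)).symm
  simp only [← mul_assoc]
  cases a with
  | t i =>
    cases b with
    | t j => simp [Gen.pos] at hlt
    | s j hj =>
      obtain rfl : 3 = j := hlt
      exact (PresentedMonoid.mk_eq_mk_of_rel (Rel.braid_st hj i)).symm
  | s i hi =>
    cases b with
    | t j => simp only [Gen.pos] at hlt; omega
    | s j hj => exact PresentedMonoid.mk_eq_mk_of_rel (Rel.braid_ss i j hi hj hlt)

theorem circle {a b : Gen e r} (h : a.pos = b.pos) :
    gen a * gen a.pred = gen b * gen b.pred := by
  by_cases hne : a = b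
  · rw [hne]
  obtain ⟨i, j, -, rfl, rfl⟩ := Gen.eq_t_of_pos_eq hne h
  exact PresentedMonoid.mk_eq_mk_of_rel (Rel.circle i j)

theorem Adj.braid_assoc {a b : Gen e r} (h : Adj a b) (z : BraidMonoid e r) :
    gen a * (gen b * (gen a * z)) = gen b * (gen a * (gen b * z)) := by
  simpa only [mul_assoc] using congrArg (· * z) h.braid

theorem circle_assoc {a b : Gen e r} (h : a.pos = b.pos) (z : BraidMonoid e r) :
    gen a * (gen a.pred * z) = gen b * (gen b.pred * z) := by
  simpa only [mul_assoc] using congrArg (· * z) (circle h)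

theorem circle_shift {a b : Gen e r} (h : Adj a b) (z : BraidMonoid e r) :
    gen b * (gen a * (gen a.pred * (gen b * (gen a.pred.pred * z)))) =
      gen a.pred * (gen b * (gen a.pred * (gen a.pred.pred * (gen b * z)))) := by
  have h₁ : Adj a.pred b := by simpa [Adj] using h
  have h₂ : Adj a.pred.pred b := by simpa [Adj] using h
  rw [circle_assoc (a := a) (b := a.pred) (by simp), h₂.braid_assoc, h₁.symm.braid_assoc]

/-- The expected solutions `u`, `v` of `a u = b v` for generators `a`, `b`: right multiples of the
solution that a single defining relation provides. -/
inductive OneStep : Gen e r → BraidMonoid e r → Gen e r → BraidMonoid e r → Prop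
  | refl (a : Gen e r) (u : BraidMonoid e r) : OneStep a u a u
  | circle {a b : Gen e r} (hne : a ≠ b) (h : a.pos = b.pos) (w : BraidMonoid e r) :
      OneStep a (gen a.pred * w) b (gen b.pred * w)
  | far {a b : Gen e r} (h : Far a b) (w : BraidMonoid e r) :
      OneStep a (gen b * w) b (gen a * w)
  | adj {a b : Gen e r} (h : Adj a b) (w : BraidMonoid e r) :
      OneStep a (gen b * (gen a * w)) b (gen a * (gen b * w))

namespace OneStep

variable {a b c : Gen e r} {u v x y : BraidMonoid e r}

theorem symm (h : OneStep a u b v) : OneStep b v a u := by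
  cases h with
  | refl => exact .refl _ _
  | circle hne h w => exact .circle hne.symm h.symm w
  | far h w => exact .far h.symm w
  | adj h w => exact .adj h.symm w

theorem mul_right (h : OneStep a u b v) (z : BraidMonoid e r) :
    OneStep a (u * z) b (v * z) := by
  cases h with
  | refl => exact .refl _ _
  | circle hne h w => simpa only [mul_assoc] using OneStep.circle hne h (w * z)
  | far h w => simpa only [mul_assoc] using OneStep.far h (w * z)
  | adj h w => simpa only [mul_assoc] using OneStep.adj h (w * z)

theorem eq (h : OneStep a u a v) : u = v := by
  cases h with
  | refl => rfl
  | circle hne => exact absurd rfl hne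
  | far h => simp [Far] at h
  | adj h => simp [Adj] at h

theorem exists_circle (h : OneStep a u b v) (hne : a ≠ b) (hp : a.pos = b.pos) :
    ∃ w, u = gen a.pred * w ∧ v = gen b.pred * w := by
  cases h with
  | refl => exact absurd rfl hne
  | circle _ _ w => exact ⟨w, rfl, rfl⟩
  | far h => simp only [Far] at h; omega
  | adj h => simp only [Adj] at h; omega

theorem exists_far (h : OneStep a u b v) (hp : Far a b) : ∃ w, u = gen b * w ∧ v = gen a * w := by
  simp only [Far] at hp
  cases h with
  | refl | circle => omega
  | far _ w => exact ⟨w, rfl, rfl⟩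
  | adj h => simp only [Adj] at h; omega

theorem exists_adj (h : OneStep a u b v) (hp : Adj a b) :
    ∃ w, u = gen b * (gen a * w) ∧ v = gen a * (gen b * w) := by
  simp only [Adj] at hp
  cases h with
  | refl | circle => omega
  | far h => simp only [Far] at h; omega
  | adj _ w => exact ⟨w, rfl, rfl⟩

theorem exists_of_rel {x y : FreeMonoid (Gen e r)} (h : Rel e r x y) :
    ∃ a u b v, x = FreeMonoid.of a * u ∧ y = FreeMonoid.of b * v ∧
      OneStep a (PresentedMonoid.mk (Rel e r) u) b (PresentedMonoid.mk (Rel e r) v) := by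
  cases h with
  | braid_ss i j hi hj hij =>
    exact ⟨_, _, _, _, mul_assoc _ _ _, mul_assoc _ _ _,
      .adj (a := .s i hi) (b := .s j hj) (.inl hij) 1⟩
  | comm_ss i j hi hj hij =>
    exact ⟨_, _, _, _, rfl, rfl, .far (a := .s i hi) (b := .s j hj) (.inl hij) 1⟩
  | braid_st h i =>
    exact ⟨_, _, _, _, mul_assoc _ _ _, mul_assoc _ _ _,
      .adj (a := .s 3 h) (b := .t i) (.inr rfl) 1⟩
  | comm_st j hj h4 i =>
    exact ⟨_, _, _, _, rfl, rfl, .far (a := .s j hj) (b := .t i) (.inr h4) 1⟩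
  | circle i j =>
    refine ⟨_, _, _, _, rfl, rfl, ?_⟩
    by_cases hij : i = j
    · subst hij; exact .refl _ _
    · exact .circle (a := .t i) (b := .t j) (by simpa using hij) rfl 1

theorem far_mul_left (h : OneStep a u b v) (ha : Far c a) (hb : Far c b) :
    OneStep a (gen c * u) b (gen c * v) := by
  cases h with
  | refl => exact .refl _ _
  | circle hne h w =>
    have ha' : Far c a.pred := by simpa [Far] using ha
    have hb' : Far c b.pred := by simpa [Far] using hb
    rw [ha'.commute.left_comm, hb'.commute.left_comm]
    exact .circle hne h _
  | far h w =>
    rw [ha.commute.left_comm, hb.commute.left_comm]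
    exact .far h _
  | adj h w =>
    simp only [ha.commute.left_comm, hb.commute.left_comm]
    exact .adj h _

/-- The equations shorter than `w` have the expected solutions. -/
abbrev OneStepBelow (w : BraidMonoid e r) : Prop := SolvedBelow (rels := Rel e r) OneStep (len w)

-- In `cube_p_q` the letters `a`, `c` are related by `p` and the letters `c`, `b` by `q`; the
-- hypothesis `h` equates the two descriptions of the common tail `w` in `a u = c w = b v`.
theorem cube_circle_circle (H : OneStepBelow (gen c.pred * x))
    (hac : a.pos = c.pos) (hcb : c.pos = b.pos) (h : gen c.pred * x = gen c.pred * y) :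
    OneStep a (gen a.pred * x) b (gen b.pred * y) := by
  obtain rfl := (H h (by simp)).eq
  by_cases hab : a = b
  · subst hab; exact .refl _ _
  · exact .circle hab (hac.trans hcb) _

theorem cube_circle_far (H : OneStepBelow (gen c.pred * x))
    (hac : a.pos = c.pos) (hcb : Far c b) (h : gen c.pred * x = gen b * y) :
    OneStep a (gen a.pred * x) b (gen c * y) := by
  have hcb' : Far c.pred b := by simpa [Far] using hcb
  have hab : Far a b := by simpa [Far, hac] using hcb
  have hab' : Far a.pred b := by simpa [Far] using hab
  obtain ⟨z, rfl, rfl⟩ := (H h (by simp)).exists_far hcb'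
  rw [hab'.commute.left_comm, circle_assoc (a := c) (b := a) hac.symm]
  exact .far hab _

theorem cube_circle_adj (H : OneStepBelow (gen c.pred * x)) (hne : a ≠ c)
    (hac : a.pos = c.pos) (hcb : Adj c b) (h : gen c.pred * x = gen b * (gen c * y)) :
    OneStep a (gen a.pred * x) b (gen c * (gen b * y)) := by
  have hab : Adj a b := by simpa [Adj, hac] using hcb
  have hab' : Adj a.pred b := by simpa [Adj] using hab
  have hcb' : Adj c.pred b := by simpa [Adj] using hcb
  have hcb'' : Adj c.pred.pred b := by simpa [Adj] using hcb
  obtain ⟨x', rfl, hy⟩ := (H h (by simp)).exists_adj hcb'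
  obtain ⟨y', hx, rfl⟩ := (H hy.symm (by simp; omega)).exists_circle
    (Gen.pred_ne_self hne.symm hac.symm) (by simp)
  obtain ⟨z, rfl, rfl⟩ := (H hx (by simp; omega)).exists_adj hcb''.symm
  have e₁ := circle_assoc (a := c.pred) (b := a.pred) (by simp [hac])
  rw [e₁, ← circle_shift hab, ← hcb'.braid_assoc, e₁, circle_assoc (a := c) (b := a) hac.symm,
    hab'.braid_assoc]
  exact .adj hab _

theorem cube_far_adj (H : OneStepBelow (gen a * x))
    (hac : Far a c) (hcb : Adj c b) (h : gen a * x = gen b * (gen c * y)) :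
    OneStep a (gen c * x) b (gen c * (gen b * y)) := by
  have hab : Far a b ∨ Adj a b := by
    simp only [Far, Adj] at *; omega
  rcases hab with hab | hab
  · obtain ⟨x', rfl, hy⟩ := (H h (by simp)).exists_far hab
    obtain ⟨z, rfl, rfl⟩ := (H hy.symm (by simp; omega)).exists_far hac
    rw [hcb.braid_assoc, hab.symm.commute.left_comm, hac.symm.commute.left_comm]
    exact .far hab _
  · obtain ⟨x', rfl, hy⟩ := (H h (by simp)).exists_adj hab
    obtain ⟨y', hx, rfl⟩ := (H hy.symm (by simp; omega)).exists_far hac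
    obtain ⟨z, rfl, rfl⟩ := (H hx (by simp; omega)).exists_adj hcb.symm
    rw [hac.commute.left_comm, hcb.braid_assoc, ← hab.braid_assoc,
      hac.symm.commute.left_comm (gen b * (gen a * z)), ← hab.braid_assoc (gen c * z),
      hac.symm.commute.left_comm, hac.commute.left_comm z, hcb.braid_assoc (gen a * z)]
    exact .adj hab _

theorem cube_adj_adj_of_pos_eq (H : OneStepBelow (gen a * (gen c * x)))
    (hac : Adj a c) (hcb : Adj c b) (hne : a ≠ b) (hab : a.pos = b.pos)
    (h : gen a * (gen c * x) = gen b * (gen c * y)) :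
    OneStep a (gen c * (gen a * x)) b (gen c * (gen b * y)) := by
  have hac' : Adj c a.pred := by simpa [Adj, or_comm] using hac
  have hcb' : Adj c b.pred := by simpa [Adj] using hcb
  have hlen := congrArg len h
  obtain ⟨x', hx, hy⟩ := (H h (by simp)).exists_circle hne hab
  obtain ⟨x'', rfl, rfl⟩ := (H hx (by simp; omega)).exists_adj hac'
  obtain ⟨y'', rfl, hxy⟩ := (H hy (by simp at hlen ⊢; omega)).exists_adj hcb'
  have hxy' := (H hxy (by simp; omega)).eq
  obtain ⟨z, rfl, rfl⟩ := (H hxy' (by simp; omega)).exists_circle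
    (Gen.pred_ne_pred hne hab) (by simpa using hab)
  rw [circle_shift hac, circle_shift hcb.symm,
    circle_assoc (a := a.pred) (b := b.pred) (by simpa using hab)]
  exact .circle hne hab _

theorem cube_adj_adj_of_far (H : OneStepBelow (gen a * (gen c * x)))
    (hac : Adj a c) (hcb : Adj c b) (hab : Far a b)
    (h : gen a * (gen c * x) = gen b * (gen c * y)) :
    OneStep a (gen c * (gen a * x)) b (gen c * (gen b * y)) := by
  have hlen := congrArg len h
  obtain ⟨x', hx, hy⟩ := (H h (by simp)).exists_far hab
  obtain ⟨x'', rfl, rfl⟩ := (H hx (by simp; omega)).exists_adj hcb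
  obtain ⟨y'', rfl, hxy⟩ := (H hy (by simp at hlen ⊢; omega)).exists_adj hac.symm
  have hxy' := (H hxy (by simp; omega)).eq
  obtain ⟨z, rfl, rfl⟩ := (H hxy' (by simp; omega)).exists_far hab.symm
  have e₁ : gen c * (gen a * (gen b * (gen c * (gen a * z)))) =
      gen b * (gen c * (gen b * (gen a * (gen c * z)))) := by
    rw [hab.commute.left_comm, hac.braid_assoc, hcb.braid_assoc]
  have e₂ : gen c * (gen b * (gen a * (gen c * (gen b * z)))) =
      gen a * (gen c * (gen b * (gen a * (gen c * z)))) := by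
    rw [hab.symm.commute.left_comm, ← hcb.braid_assoc, ← hac.braid_assoc, hab.commute.left_comm]
  rw [e₁, e₂]
  exact .far hab _

theorem cube_adj_adj (H : OneStepBelow (gen a * (gen c * x)))
    (hac : Adj a c) (hcb : Adj c b) (h : gen a * (gen c * x) = gen b * (gen c * y)) :
    OneStep a (gen c * (gen a * x)) b (gen c * (gen b * y)) := by
  by_cases hne : a = b
  · subst hne
    rw [(H (H h (by simp)).eq (by simp; omega)).eq]
    exact .refl _ _
  by_cases hab : a.pos = b.pos
  · exact cube_adj_adj_of_pos_eq H hac hcb hne hab h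
  · refine cube_adj_adj_of_far H hac hcb ?_ h
    simp only [Far, Adj] at *; omega

theorem trans_of_solvedBelow {w : BraidMonoid e r} (H : OneStepBelow w)
    (h₁ : OneStep a u c w) (h₂ : OneStep c w b v) : OneStep a u b v := by
  generalize hw : w = w' at h₂
  have H' : OneStepBelow w' := hw ▸ H
  cases h₁ with
  | refl => exact hw ▸ h₂
  | circle hne hac x =>
    cases h₂ with
    | refl => exact hw ▸ .circle hne hac x
    | circle _ hcb y => exact cube_circle_circle H hac hcb hw
    | far hcb y => exact cube_circle_far H hac hcb hw
    | adj hcb y => exact cube_circle_adj H hne hac hcb hw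
  | far hac x =>
    cases h₂ with
    | refl => exact hw ▸ .far hac x
    | circle _ hcb y => exact (cube_circle_far H' hcb.symm hac.symm hw.symm).symm
    | far hcb y => exact (H hw (by simp)).far_mul_left hac.symm hcb
    | adj hcb y => exact cube_far_adj H hac hcb hw
  | adj hac x =>
    cases h₂ with
    | refl => exact hw ▸ .adj hac x
    | circle hne hcb y => exact (cube_circle_adj H' hne.symm hcb.symm hac.symm hw.symm).symm
    | far hcb y => exact (cube_far_adj H' hcb.symm hac.symm hw.symm).symm
    | adj hcb y => exact cube_adj_adj H hac hcb hw

theorem isReductionRelation : IsReductionRelation (rels := Rel e r) OneStep where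
  refl := .refl
  symm := symm
  mul_right := mul_right
  of_rel := exists_of_rel
  trans_of_solvedBelow := trans_of_solvedBelow

end OneStep

instance : IsLeftCancelMul (BraidMonoid e r) :=
  OneStep.isReductionRelation.isLeftCancelMul OneStep.eq

theorem oneStep_of_gen_mul_eq {a b : Gen e r} {u v : BraidMonoid e r}
    (h : gen a * u = gen b * v) : OneStep a u b v :=
  OneStep.isReductionRelation.of_mul_eq_of_mul h

section Divisibility

variable {a b : Gen e r} {u : BraidMonoid e r}

theorem Adj.mul_dvd (hab : Adj a b) (h : gen a ∣ gen b * u) : gen a * gen b ∣ u := by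
  obtain ⟨w, hw⟩ := h
  obtain ⟨z, rfl, rfl⟩ := (oneStep_of_gen_mul_eq hw.symm).exists_adj hab
  exact ⟨z, by rw [mul_assoc]⟩

theorem gen_pred_dvd (hne : a ≠ b) (hab : a.pos = b.pos) (h : gen a ∣ gen b * u) :
    gen b.pred ∣ u := by
  obtain ⟨w, hw⟩ := h
  obtain ⟨z, rfl, rfl⟩ := (oneStep_of_gen_mul_eq hw.symm).exists_circle hne hab
  exact ⟨z, rfl⟩

theorem Far.lcmSemiconjBy (hab : Far a b) : LcmSemiconjBy (gen b) (gen a) (gen a) := by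
  refine ⟨hab.commute.symm, fun ⟨w, hw⟩ => ?_⟩
  obtain ⟨z, rfl, rfl⟩ := (oneStep_of_gen_mul_eq hw.symm).exists_far hab
  exact ⟨z, rfl⟩

theorem Adj.lcmSemiconjBy (hab : Adj a b) : LcmSemiconjBy (gen a * gen b) (gen a) (gen b) := by
  refine ⟨by rw [SemiconjBy, mul_assoc, hab.braid], fun h => ?_⟩
  rw [mul_assoc] at h
  exact (mul_dvd_mul_left_cancel_iff _).1 (hab.symm.mul_dvd h)

end Divisibility

/-! ### Parabolic submonoids and the shift -/

theorem Gen.exists_pos_eq {j : ℕ} (hj : 2 ≤ j) (hjr : j ≤ r) : ∃ a : Gen e r, a.pos = j := by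
  rcases hj.eq_or_lt with rfl | hj
  · exact ⟨.t 0, rfl⟩
  · exact ⟨.s j ⟨hj, hjr⟩, rfl⟩

theorem Gen.exists_pos_add_one_eq {a : Gen e r} (ha : 2 < a.pos) :
    ∃ b : Gen e r, b.pos + 1 = a.pos := by
  cases a with
  | t i => exact absurd ha (lt_irrefl 2)
  | s j hj =>
    obtain ⟨j, rfl⟩ := Nat.exists_eq_add_of_le' (Nat.one_le_of_lt hj.1)
    obtain ⟨b, hb⟩ := Gen.exists_pos_eq (e := e) (r := r) (j := j) (by omega) (by omega)
    exact ⟨b, congrArg (· + 1) hb⟩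

theorem Gen.pos_le (hr : 2 ≤ r) (a : Gen e r) : a.pos ≤ r := by
  cases a with
  | t i => exact hr
  | s j h => exact h.2

/-- Sends `t_i` to `t_{i+c}` and fixes every `s_j`. -/
def Gen.shift (c : ZMod e) : Gen e r → Gen e r
  | .t i => .t (i + c)
  | .s j h => .s j h

@[simp] theorem Gen.pos_shift (c : ZMod e) (a : Gen e r) : (a.shift c).pos = a.pos := by
  cases a <;> rfl

theorem Gen.pred_shift (c : ZMod e) (a : Gen e r) : (a.shift c).pred = a.pred.shift c := by
  cases a <;> simp [Gen.pred, Gen.shift, sub_add_eq_add_sub]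

@[simp] theorem Gen.pred_shift_one (a : Gen e r) : (a.shift 1).pred = a := by
  cases a <;> simp [Gen.pred, Gen.shift]

theorem Gen.shift_shift (c d : ZMod e) (a : Gen e r) :
    (a.shift c).shift d = a.shift (c + d) := by
  cases a <;> simp [Gen.shift, add_assoc]

theorem Gen.shift_zero (a : Gen e r) : a.shift 0 = a := by
  cases a <;> simp [Gen.shift]

theorem Gen.shift_eq_self (c : ZMod e) {a : Gen e r} (h : 2 < a.pos) : a.shift c = a := by
  cases a with
  | t i => simp [Gen.pos] at h
  | s j hj => rfl

/-- The endomorphism of the monoid that sends `t_i` to `t_{i+c}` and fixes every `s_j`. -/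
def shift (c : ZMod e) : BraidMonoid e r →* BraidMonoid e r :=
  PresentedMonoid.lift (fun a => gen (a.shift c)) (by
    intro x y h
    cases h with
    | braid_ss i j hi hj hij => exact PresentedMonoid.mk_eq_mk_of_rel (.braid_ss i j hi hj hij)
    | comm_ss i j hi hj hij => exact PresentedMonoid.mk_eq_mk_of_rel (.comm_ss i j hi hj hij)
    | braid_st h i => exact PresentedMonoid.mk_eq_mk_of_rel (.braid_st h _)
    | comm_st j hj h4 i => exact PresentedMonoid.mk_eq_mk_of_rel (.comm_st j hj h4 _)
    | circle i j =>
      have := circle (a := (Gen.t i : Gen e r).shift c) (b := (Gen.t j).shift c) rfl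
      rw [Gen.pred_shift, Gen.pred_shift] at this
      exact this)

@[simp] theorem shift_gen (c : ZMod e) (a : Gen e r) : shift c (gen a) = gen (a.shift c) := rfl

theorem shift_shift_neg (c : ZMod e) (x : BraidMonoid e r) : shift c (shift (-c) x) = x := by
  induction x using induction_left with
  | one => simp only [map_one]
  | of_mul a x ih =>
    simp only [map_mul, shift_gen, ih, Gen.shift_shift, neg_add_cancel, Gen.shift_zero]

theorem shift_surjective (c : ZMod e) : Function.Surjective (shift c : BraidMonoid e r → _) :=
  fun x => ⟨_, shift_shift_neg c x⟩

/-- The homomorphism to `ℕ` that is `1` on the generators of position at most `k` and `0` on the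
others. -/
def indicator (k : ℕ) : BraidMonoid e r →* ℕ :=
  PresentedMonoid.lift (fun a => if a.pos ≤ k then 1 else 0) (by
    intro x y h
    cases h <;> simp only [map_mul, FreeMonoid.lift_eval_of, Gen.pos] <;> grind)

/-- The parabolic submonoid generated by the generators of position at most `k`. It is defined as a
kernel in order to see that it contains the factors of its elements. -/
def parabolic (e r k : ℕ) : Submonoid (BraidMonoid e r) := MonoidHom.mker (indicator k)

theorem gen_mem_parabolic {k : ℕ} {a : Gen e r} : gen a ∈ parabolic e r k ↔ a.pos ≤ k := by
  change (if a.pos ≤ k then 1 else 0) = 1 ↔ _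
  simp only [ite_eq_left_iff, zero_ne_one, imp_false, not_not]

theorem mul_mem_parabolic {k : ℕ} {x y : BraidMonoid e r} :
    x * y ∈ parabolic e r k ↔ x ∈ parabolic e r k ∧ y ∈ parabolic e r k := by
  simp only [parabolic, MonoidHom.mem_mker, map_mul, mul_eq_one]

theorem parabolic_induction {k : ℕ} {p : BraidMonoid e r → Prop} {x : BraidMonoid e r}
    (hx : x ∈ parabolic e r k) (one : p 1)
    (gen_mul : ∀ a x, a.pos ≤ k → p x → p (gen a * x)) : p x := by
  induction x using induction_left with
  | one => exact one
  | of_mul a x ih =>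
    rw [mul_mem_parabolic, gen_mem_parabolic] at hx
    exact gen_mul a x hx.1 (ih hx.2)

theorem parabolic_mono {k l : ℕ} (hkl : k ≤ l) : parabolic e r k ≤ parabolic e r l := fun _ hx =>
  parabolic_induction hx (one_mem _) fun _ _ ha hx =>
    mul_mem (gen_mem_parabolic.2 (ha.trans hkl)) hx

theorem shift_mem_parabolic {k : ℕ} (c : ZMod e) {x : BraidMonoid e r}
    (hx : x ∈ parabolic e r k) : shift c x ∈ parabolic e r k :=
  parabolic_induction (p := fun x => shift c x ∈ parabolic e r k) hx
    (by simp only [map_one, one_mem]) fun a x ha hx => by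
      rw [map_mul, shift_gen]
      exact mul_mem (gen_mem_parabolic.2 (by rwa [Gen.pos_shift])) hx

theorem lcmSemiconjBy_gen_of_mem_parabolic {k : ℕ} {a : Gen e r} (ha : k + 1 < a.pos)
    {x : BraidMonoid e r} (hx : x ∈ parabolic e r k) : LcmSemiconjBy x (gen a) (gen a) :=
  parabolic_induction (p := fun x => LcmSemiconjBy x (gen a) (gen a)) hx (.one_left _)
    fun b _ hb hx =>
      (Far.lcmSemiconjBy (.inr (by omega))).mul_left hx

theorem gen_lcmSemiconjBy_of_mem_parabolic {k : ℕ} {a : Gen e r} (ha : k + 1 < a.pos)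
    {x : BraidMonoid e r} (hx : x ∈ parabolic e r k) : LcmSemiconjBy (gen a) x x :=
  parabolic_induction (p := fun x => LcmSemiconjBy (gen a) x x) hx (.one_right _) fun b _ hb hx =>
    (Far.lcmSemiconjBy (.inl (by omega))).mul_right hx

theorem commute_gen_of_mem_parabolic {k : ℕ} {a : Gen e r} (ha : k + 1 < a.pos)
    {x : BraidMonoid e r} (hx : x ∈ parabolic e r k) : Commute (gen a) x :=
  (gen_lcmSemiconjBy_of_mem_parabolic ha hx).semiconjBy

/-! ### The elements `Λ_k` -/

theorem s_eq_gen {a : Gen e r} (ha : 2 < a.pos) : s e r a.pos = gen a := by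
  cases a with
  | t i => simp [Gen.pos] at ha
  | s j hj => exact dif_pos hj

theorem Lam_two {a : Gen e r} (ha : a.pos = 2) : Lam e r 2 = gen a * gen a.pred := by
  cases a with
  | t i => exact tau_eq e r i
  | s j hj => simp only [Gen.pos] at ha; omega

theorem Lam_succ {k : ℕ} (hk : 2 ≤ k) {a : Gen e r} (ha : a.pos = k + 1) :
    Lam e r (k + 1) = gen a * Lam e r k * gen a := by
  obtain ⟨k, rfl⟩ := Nat.exists_eq_add_of_le' hk
  rw [Lam, ← s_eq_gen (a := a) (by omega), ha]

theorem s_mem_parabolic (k : ℕ) : s e r k ∈ parabolic e r k := by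
  rw [s]
  split
  · exact gen_mem_parabolic.2 le_rfl
  · exact one_mem _

theorem Lam_mem_parabolic {k : ℕ} (hk : 2 ≤ k) : Lam e r k ∈ parabolic e r k := by
  induction k, hk using Nat.le_induction with
  | base =>
    rw [Lam_two (a := .t 0) rfl]
    exact mul_mem (gen_mem_parabolic.2 le_rfl) (gen_mem_parabolic.2 le_rfl)
  | succ k hk ih =>
    obtain ⟨k, rfl⟩ := Nat.exists_eq_add_of_le' hk
    exact mul_mem (mul_mem (s_mem_parabolic _) (parabolic_mono (Nat.le_succ _) ih))
      (s_mem_parabolic _)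

theorem shift_s (c : ZMod e) (k : ℕ) : shift c (s e r k) = s e r k := by
  rw [s]
  split
  · rfl
  · exact map_one _

theorem shift_Lam (c : ZMod e) {k : ℕ} (hk : 2 ≤ k) : shift c (Lam e r k) = Lam e r k := by
  induction k, hk using Nat.le_induction with
  | base =>
    rw [Lam_two (a := .t 0) rfl, map_mul, shift_gen, shift_gen, ← Gen.pred_shift]
    exact circle rfl
  | succ k hk ih =>
    obtain ⟨k, rfl⟩ := Nat.exists_eq_add_of_le' hk
    rw [Lam, map_mul, map_mul, ih, shift_s]

theorem Lam_lcmSemiconjBy {k : ℕ} (hkr : k ≤ r) {a : Gen e r} (ha : a.pos < k) :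
    LcmSemiconjBy (Lam e r k) (gen a) (gen (a.shift 1)) := by
  induction k, (a.two_le_pos.trans ha.le) using Nat.le_induction with
  | base => exact absurd ha a.two_le_pos.not_gt
  | succ k hk ih =>
    obtain ⟨b, hb⟩ := Gen.exists_pos_eq (e := e) (r := r) (j := k + 1) (by omega) hkr
    rw [Lam_succ hk hb]
    rcases Nat.lt_succ_iff_lt_or_eq.1 ha with hlt | rfl
    · have hab : Far a b := .inl (by omega)
      have hab' : Far (a.shift 1) b := by simpa [Far] using hab
      exact (hab'.lcmSemiconjBy.mul_left (ih (by omega) hlt)).mul_left hab.lcmSemiconjBy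
    have hab : Adj a b := .inl hb.symm
    rcases hk.eq_or_lt with h2 | h2
    · have hab' : Adj b (a.shift 1) := by simpa [Adj, or_comm] using hab
      rw [← h2, Lam_two (a := a.shift 1) (by simpa using h2.symm), Gen.pred_shift_one]
      simpa only [mul_assoc] using hab'.lcmSemiconjBy.mul_left hab.lcmSemiconjBy
    · obtain ⟨l, hl⟩ := Nat.exists_eq_add_of_le' (Nat.le_of_succ_le h2)
      have hlow : LcmSemiconjBy (Lam e r (l + 1)) (gen b) (gen b) :=
        lcmSemiconjBy_gen_of_mem_parabolic (k := l + 1) (by omega)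
          (Lam_mem_parabolic (by omega))
      rw [hl, Lam_succ (by omega) hl, Gen.shift_eq_self _ h2]
      simpa only [mul_assoc] using
        (hab.symm.lcmSemiconjBy.mul_left hlow).mul_left hab.lcmSemiconjBy

theorem Lam_semiconjBy {k : ℕ} (hkr : k + 1 ≤ r) {x : BraidMonoid e r}
    (hx : x ∈ parabolic e r k) : SemiconjBy (Lam e r (k + 1)) x (shift 1 x) :=
  parabolic_induction (p := fun x => SemiconjBy _ x (shift 1 x)) hx (by simp) fun a x ha hx => by
    rw [map_mul]
    exact (Lam_lcmSemiconjBy hkr (Nat.lt_succ_of_le ha)).semiconjBy.mul_right hx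

theorem Lam_three_dvd_of_gen_dvd [Nontrivial (ZMod e)] {a : Gen e r} (ha : a.pos = 3)
    {u : BraidMonoid e r} (h : gen a ∣ Lam e r 2 * u) : Lam e r 3 ∣ u := by
  let b : Gen e r := .t 0
  have hba : Adj b a := .inl ha.symm
  have hba' : Adj b.pred a := .inl ha.symm
  have hba'' : Adj b.pred.pred a := .inl ha.symm
  rw [Lam_two (a := b) rfl, mul_assoc] at h
  have h₁ : gen a * gen b ∣ gen b.pred * u := hba.symm.mul_dvd h
  obtain ⟨w, rfl⟩ : gen a * gen b.pred ∣ u :=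
    hba'.symm.mul_dvd ((dvd_mul_right _ _).trans h₁)
  rw [mul_assoc, ← hba'.symm.braid_assoc, mul_dvd_mul_left_cancel_iff] at h₁
  have h₂ : gen b.pred.pred ∣ gen a * w :=
    gen_pred_dvd (a := b) (by simp [Gen.pred, b]) rfl h₁
  rw [Lam_succ le_rfl ha, Lam_two (a := b.pred) rfl]
  simp only [mul_assoc]
  exact mul_dvd_mul_left _ (mul_dvd_mul_left _ (hba''.mul_dvd h₂))

theorem Lam_dvd_of_gen_dvd [Nontrivial (ZMod e)] {k : ℕ} (hk : 2 ≤ k) {a : Gen e r}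
    (ha : a.pos = k + 1) {u : BraidMonoid e r} (h : gen a ∣ Lam e r k * u) :
    Lam e r (k + 1) ∣ u := by
  induction k, hk using Nat.le_induction generalizing a u with
  | base => exact Lam_three_dvd_of_gen_dvd ha h
  | succ k hk ih =>
    obtain ⟨b, hb⟩ := Gen.exists_pos_add_one_eq (a := a) (by omega)
    have hba : Adj b a := .inl hb
    have hΛa : LcmSemiconjBy (Lam e r k) (gen a) (gen a) :=
      lcmSemiconjBy_gen_of_mem_parabolic (by omega) (Lam_mem_parabolic hk)
    rw [Lam_succ hk (a := b) (by omega), mul_assoc, mul_assoc] at h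
    have h₁ : gen a * gen b ∣ Lam e r k * (gen b * u) := hba.symm.mul_dvd h
    obtain ⟨w, rfl⟩ : gen a * gen b ∣ u :=
      hba.symm.mul_dvd (hΛa.dvd_of_dvd_mul ((dvd_mul_right _ _).trans h₁))
    rw [mul_assoc, hba.braid_assoc, ← mul_assoc (Lam e r k), hΛa.semiconjBy.eq, mul_assoc,
      mul_dvd_mul_left_cancel_iff] at h₁
    have h₂ : Lam e r (k + 1) ∣ gen b * (gen a * w) := ih (by omega) h₁
    rw [Lam_succ hk (a := b) (by omega), mul_assoc, mul_dvd_mul_left_cancel_iff] at h₂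
    have hΛa' : LcmSemiconjBy (gen a) (Lam e r k) (Lam e r k) :=
      gen_lcmSemiconjBy_of_mem_parabolic (by omega) (Lam_mem_parabolic hk)
    obtain ⟨v, rfl⟩ : Lam e r k ∣ w :=
      hΛa'.dvd_of_dvd_mul ((dvd_mul_right _ _).trans h₂)
    rw [← mul_assoc (gen a), hΛa'.semiconjBy.eq, mul_assoc, mul_dvd_mul_left_cancel_iff] at h₂
    rw [Lam_succ (by omega) ha, Lam_succ hk (a := b) (by omega)]
    simp only [mul_assoc]
    iterate 3 apply mul_dvd_mul_left
    exact hba.mul_dvd h₂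

/-! ### The elements `s_{m+1} ⋯ s_k` -/

/-- The product `s_{m+1} s_{m+2} ⋯ s_k`. -/
def tail (e r m k : ℕ) : BraidMonoid e r := ((List.range' (m + 1) (k - m)).map (s e r)).prod

@[simp] theorem tail_self (k : ℕ) : tail e r k k = 1 := by simp [tail]

theorem tail_eq_s_mul {m k : ℕ} (hmk : m < k) :
    tail e r m k = s e r (m + 1) * tail e r (m + 1) k := by
  obtain ⟨l, rfl⟩ := Nat.exists_eq_add_of_lt hmk
  rw [tail, tail, show m + l + 1 - m = l + 1 by omega, show m + l + 1 - (m + 1) = l by omega,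
    List.range'_succ, List.map_cons, List.prod_cons]

theorem tail_eq_gen_mul {m k : ℕ} (hm : 2 ≤ m) (hmk : m < k) {a : Gen e r}
    (ha : a.pos = m + 1) : tail e r m k = gen a * tail e r (m + 1) k := by
  rw [tail_eq_s_mul hmk, ← ha, s_eq_gen (by omega)]

theorem tail_mul_tail {l m k : ℕ} (hlm : l ≤ m) (hmk : m ≤ k) :
    tail e r l m * tail e r m k = tail e r l k := by
  induction hlm using Nat.decreasingInduction with
  | self => rw [tail_self, one_mul]
  | of_succ l hlm ih => rw [tail_eq_s_mul hlm, mul_assoc, ih, tail_eq_s_mul (hlm.trans_le hmk)]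

theorem tail_mem_parabolic {m k : ℕ} (hmk : m ≤ k) : tail e r m k ∈ parabolic e r k := by
  induction hmk using Nat.decreasingInduction with
  | self => simp only [tail_self, one_mem]
  | of_succ m hmk ih =>
    rw [tail_eq_s_mul hmk]
    exact mul_mem (parabolic_mono hmk (s_mem_parabolic _)) ih

theorem s_lcmSemiconjBy_of_mem_parabolic {m j : ℕ} (hmj : m + 1 < j) {x : BraidMonoid e r}
    (hx : x ∈ parabolic e r m) : LcmSemiconjBy (s e r j) x x := by
  rw [s]
  split
  · exact gen_lcmSemiconjBy_of_mem_parabolic hmj hx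
  · exact .one_left x

theorem tail_lcmSemiconjBy_of_mem_parabolic {l m k : ℕ} (hlm : l < m) (hmk : m ≤ k)
    {x : BraidMonoid e r} (hx : x ∈ parabolic e r l) : LcmSemiconjBy (tail e r m k) x x := by
  induction hmk using Nat.decreasingInduction with
  | self => rw [tail_self]; exact .one_left x
  | of_succ m hmk ih =>
    rw [tail_eq_s_mul hmk]
    exact (s_lcmSemiconjBy_of_mem_parabolic (Nat.succ_lt_succ hlm) hx).mul_left (ih (by omega))

theorem tail_lcmSemiconjBy_gen {m k : ℕ} (hm : 2 ≤ m) {a b : Gen e r} (hba : b.pos + 1 = a.pos)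
    (hma : m + 1 < a.pos) (hak : a.pos ≤ k) :
    LcmSemiconjBy (tail e r m k) (gen b) (gen a) := by
  obtain ⟨l, hl⟩ := Nat.exists_eq_add_of_le' (Nat.one_le_of_lt b.two_le_pos)
  have hab : Adj b a := .inl hba
  have hsplit : tail e r m k = tail e r m l * (gen b * gen a * tail e r (l + 1 + 1) k) := by
    rw [mul_assoc (gen b), ← tail_eq_gen_mul (by omega) (by omega) (by omega : a.pos = l + 1 + 1),
      ← tail_eq_gen_mul (by omega) (by omega) hl, tail_mul_tail (by omega) (by omega)]
  have hleft : LcmSemiconjBy (tail e r m l) (gen a) (gen a) :=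
    lcmSemiconjBy_gen_of_mem_parabolic (by omega) (tail_mem_parabolic (by omega))
  have hright : LcmSemiconjBy (tail e r (l + 1 + 1) k) (gen b) (gen b) :=
    tail_lcmSemiconjBy_of_mem_parabolic l.succ.lt_succ_self (by omega)
      (gen_mem_parabolic.2 hl.le)
  rw [hsplit]
  exact hleft.mul_left (hab.lcmSemiconjBy.mul_left hright)

theorem not_gen_dvd_tail_mul {m k : ℕ} (hmk : m ≤ k + 1) (hkr : k + 1 ≤ r) {a : Gen e r}
    (ha : a.pos = m) {u : BraidMonoid e r} (hu : u ∈ parabolic e r k) :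
    ¬ gen a ∣ tail e r m (k + 1) * u := by
  intro h
  induction hmk using Nat.decreasingInduction generalizing a u with
  | self =>
    rw [tail_self, one_mul] at h
    obtain ⟨v, rfl⟩ := h
    have := gen_mem_parabolic.1 (mul_mem_parabolic.1 hu).1
    omega
  | of_succ m hmk ih =>
    have ha2 := a.two_le_pos
    obtain ⟨b, hb⟩ := Gen.exists_pos_eq (e := e) (r := r) (j := m + 1) (by omega) (by omega)
    have hab : Adj a b := .inl (by omega)
    have htail : LcmSemiconjBy (tail e r (m + 1) (k + 1)) (gen a) (gen a) :=
      tail_lcmSemiconjBy_of_mem_parabolic m.lt_succ_self hmk (gen_mem_parabolic.2 ha.le)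
    rw [tail_eq_gen_mul (by omega) hmk hb, mul_assoc] at h
    have h₁ : gen a * gen b ∣ tail e r (m + 1) (k + 1) * u := hab.mul_dvd h
    obtain ⟨v, rfl⟩ : gen a ∣ u := htail.dvd_of_dvd_mul ((dvd_mul_right _ _).trans h₁)
    rw [← mul_assoc, htail.semiconjBy.eq, mul_assoc, mul_dvd_mul_left_cancel_iff] at h₁
    exact ih hb (mul_mem_parabolic.1 hu).2 h₁

/-! ### Right divisors of `Λ_k` -/

/-- The right divisors of `Λ_k`, listed explicitly. -/
inductive IsLamSuffix (k : ℕ) : BraidMonoid e r → Prop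
  | tail (m : ℕ) (hm : 2 ≤ m) (hmk : m ≤ k) : IsLamSuffix k (tail e r m k)
  | gen_mul_tail (c : Gen e r) (hc : c.pos = 2) : IsLamSuffix k (gen c * BraidMonoid.tail e r 2 k)
  | Lam_mul_tail (m : ℕ) (hm : 2 ≤ m) (hmk : m ≤ k) :
      IsLamSuffix k (Lam e r m * BraidMonoid.tail e r m k)

/-- What can happen when a generator `a` is to divide `q * u`, where `q` is a right divisor of
`Λ_{k+1}` and `u` lies in the parabolic submonoid below: `a` is a left divisor of `q`, or it slides
through `q` and becomes a left divisor of `u`, or it never divides. -/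
inductive SlideCase (k : ℕ) (a : Gen e r) : BraidMonoid e r → Prop
  | strip (q : BraidMonoid e r) (hq : IsLamSuffix (k + 1) q) : SlideCase k a (gen a * q)
  | slide (q : BraidMonoid e r) (b : Gen e r) (h : LcmSemiconjBy q (gen b) (gen a)) :
      SlideCase k a q
  | avoid (q : BraidMonoid e r) (h : ∀ u ∈ parabolic e r k, ¬ gen a ∣ q * u) : SlideCase k a q

section SlideCase

variable {k m : ℕ} {a : Gen e r}

theorem slideCase_tail (hkr : k + 1 ≤ r) (hak : a.pos ≤ k + 1) (hm : 2 ≤ m) (hmk : m ≤ k + 1) :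
    SlideCase k a (tail e r m (k + 1)) := by
  rcases lt_trichotomy a.pos m with ham | ham | ham
  · exact .slide _ a (tail_lcmSemiconjBy_of_mem_parabolic ham hmk (gen_mem_parabolic.2 le_rfl))
  · exact .avoid _ fun u hu => not_gen_dvd_tail_mul hmk hkr ham hu
  rcases (Nat.succ_le_of_lt ham).eq_or_lt with ham' | ham'
  · rw [tail_eq_gen_mul hm (by omega) ham'.symm]
    exact .strip _ (.tail (m + 1) (by omega) (by omega))
  · obtain ⟨b, hb⟩ := Gen.exists_pos_add_one_eq (hm.trans_lt ham)
    exact .slide _ b (tail_lcmSemiconjBy_gen hm hb ham' hak)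

theorem slideCase_gen_mul_tail (hk : 2 ≤ k + 1) (hkr : k + 1 ≤ r) (hak : a.pos ≤ k + 1)
    {c : Gen e r} (hc : c.pos = 2) : SlideCase k a (gen c * tail e r 2 (k + 1)) := by
  rcases a.two_le_pos.eq_or_lt with ha2 | ha2
  · by_cases hac : a = c
    · rw [hac]
      exact .strip _ (.tail 2 le_rfl hk)
    · refine .avoid _ fun u hu h => ?_
      rw [mul_assoc] at h
      exact not_gen_dvd_tail_mul hk hkr (by rwa [Gen.pos_pred]) hu
        (gen_pred_dvd hac (ha2.symm.trans hc.symm) h)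
  rcases (Nat.succ_le_of_lt ha2).eq_or_lt with ha3 | ha3
  · have hca : Adj c a := .inl (by omega)
    have htail : LcmSemiconjBy (tail e r 3 (k + 1)) (gen c) (gen c) :=
      tail_lcmSemiconjBy_of_mem_parabolic (by omega) (by omega) (gen_mem_parabolic.2 hc.le)
    rw [tail_eq_gen_mul le_rfl (by omega) ha3.symm, ← mul_assoc]
    exact .slide _ c (hca.lcmSemiconjBy.mul_left htail)
  · obtain ⟨b, hb⟩ := Gen.exists_pos_add_one_eq ha2
    have hac : Far a c := .inr (by omega)
    exact .slide _ b (hac.lcmSemiconjBy.mul_left (tail_lcmSemiconjBy_gen le_rfl hb ha3 hak))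

theorem not_gen_dvd_Lam_mul_tail_mul [Nontrivial (ZMod e)] (hkr : k + 1 ≤ r) (hm : 2 ≤ m)
    (hmk : m < k + 1) (ha : a.pos = m + 1) {u : BraidMonoid e r} (hu : u ∈ parabolic e r k) :
    ¬ gen a ∣ Lam e r m * tail e r m (k + 1) * u := by
  intro h
  have htail : LcmSemiconjBy (tail e r (m + 1) (k + 1)) (Lam e r m) (Lam e r m) :=
    tail_lcmSemiconjBy_of_mem_parabolic m.lt_succ_self hmk (Lam_mem_parabolic hm)
  rw [mul_assoc] at h
  have h₁ : Lam e r m * gen a ∣ tail e r (m + 1) (k + 1) * u := by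
    have := Lam_dvd_of_gen_dvd hm ha h
    rwa [Lam_succ hm ha, tail_eq_gen_mul hm hmk ha, mul_assoc, mul_assoc,
      mul_dvd_mul_left_cancel_iff] at this
  obtain ⟨v, rfl⟩ : Lam e r m ∣ u := htail.dvd_of_dvd_mul ((dvd_mul_right _ _).trans h₁)
  rw [← mul_assoc, htail.semiconjBy.eq, mul_assoc, mul_dvd_mul_left_cancel_iff] at h₁
  exact not_gen_dvd_tail_mul hmk hkr ha (mul_mem_parabolic.1 hu).2 h₁

theorem slideCase_Lam_mul_tail [Nontrivial (ZMod e)] (hkr : k + 1 ≤ r) (hak : a.pos ≤ k + 1)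
    (hm : 2 ≤ m) (hmk : m ≤ k + 1) : SlideCase k a (Lam e r m * tail e r m (k + 1)) := by
  rcases lt_trichotomy a.pos m with ham | rfl | ham
  · have htail : LcmSemiconjBy (tail e r m (k + 1)) (gen (a.shift (-1))) (gen (a.shift (-1))) :=
      tail_lcmSemiconjBy_of_mem_parabolic ham hmk (gen_mem_parabolic.2 (by rw [Gen.pos_shift]))
    have hΛ := Lam_lcmSemiconjBy (hmk.trans hkr) (a := a.shift (-1)) (by rwa [Gen.pos_shift])
    rw [Gen.shift_shift, neg_add_cancel, Gen.shift_zero] at hΛ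
    exact .slide _ _ (hΛ.mul_left htail)
  · rcases hm.eq_or_lt with h2 | h2
    · rw [← h2, Lam_two h2.symm, mul_assoc]
      exact .strip _ (.gen_mul_tail _ (by rw [Gen.pos_pred, h2]))
    · obtain ⟨l, hl⟩ := Nat.exists_eq_add_of_le' (Nat.one_le_of_lt h2)
      rw [hl, Lam_succ (by omega) hl, mul_assoc, mul_assoc,
        ← tail_eq_gen_mul (by omega) (by omega) hl]
      exact .strip _ (.Lam_mul_tail l (by omega) (by omega))
  rcases (Nat.succ_le_of_lt ham).eq_or_lt with ham' | ham'
  · exact .avoid _ fun u hu => not_gen_dvd_Lam_mul_tail_mul hkr hm (by omega) ham'.symm hu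
  · obtain ⟨b, hb⟩ := Gen.exists_pos_add_one_eq (hm.trans_lt ham)
    have hΛ : LcmSemiconjBy (Lam e r m) (gen a) (gen a) :=
      lcmSemiconjBy_gen_of_mem_parabolic ham' (Lam_mem_parabolic hm)
    exact .slide _ b (hΛ.mul_left (tail_lcmSemiconjBy_gen hm hb ham' hak))

theorem IsLamSuffix.slideCase [Nontrivial (ZMod e)] (hk : 2 ≤ k + 1) (hkr : k + 1 ≤ r)
    (hak : a.pos ≤ k + 1) {q : BraidMonoid e r} (hq : IsLamSuffix (k + 1) q) :
    SlideCase k a q := by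
  cases hq with
  | tail m hm hmk => exact slideCase_tail hkr hak hm hmk
  | gen_mul_tail c hc => exact slideCase_gen_mul_tail hk hkr hak hc
  | Lam_mul_tail m hm hmk => exact slideCase_Lam_mul_tail hkr hak hm hmk

end SlideCase

/-! ### The elements `Δ_k` and their divisors -/

/-- The product `p_2 p_3 ⋯ p_k`. -/
def prodTo (k : ℕ) (p : ℕ → BraidMonoid e r) : BraidMonoid e r :=
  ((List.range' 2 (k - 1)).map p).prod

theorem prodTo_succ {k : ℕ} (hk : 1 ≤ k) (p : ℕ → BraidMonoid e r) :
    prodTo (k + 1) p = prodTo k p * p (k + 1) := by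
  obtain ⟨k, rfl⟩ := Nat.exists_eq_add_of_le' hk
  have h : 2 + k = k + 1 + 1 := by omega
  simp [prodTo, List.range'_concat, h]

theorem prodTo_congr {k : ℕ} {p q : ℕ → BraidMonoid e r}
    (h : ∀ j, 2 ≤ j → j ≤ k → p j = q j) : prodTo k p = prodTo k q := by
  refine congrArg List.prod (List.map_congr_left fun j hj => ?_)
  rw [List.mem_range'_1] at hj
  exact h j hj.1 (by omega)

/-- The element `Δ_k = Λ_2 Λ_3 ⋯ Λ_k`. -/
def DeltaTo (e r k : ℕ) : BraidMonoid e r := prodTo k (Lam e r)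

theorem DeltaTo_one : DeltaTo e r 1 = 1 := rfl

theorem DeltaTo_succ {k : ℕ} (hk : 1 ≤ k) :
    DeltaTo e r (k + 1) = DeltaTo e r k * Lam e r (k + 1) :=
  prodTo_succ hk _

theorem DeltaTo_two : DeltaTo e r 2 = Lam e r 2 := by
  rw [DeltaTo_succ le_rfl, DeltaTo_one, one_mul]

theorem DeltaTo_mem_parabolic {k : ℕ} (hk : 1 ≤ k) : DeltaTo e r k ∈ parabolic e r k := by
  induction k, hk using Nat.le_induction with
  | base => exact one_mem _
  | succ k hk ih =>
    rw [DeltaTo_succ hk]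
    exact mul_mem (parabolic_mono k.le_succ ih) (Lam_mem_parabolic (Nat.succ_le_succ hk))

theorem mul_Lam_eq {k : ℕ} (hkr : k + 1 ≤ r) {x : BraidMonoid e r} (hx : x ∈ parabolic e r k) :
    x * Lam e r (k + 1) = Lam e r (k + 1) * shift (-1) x := by
  have h := Lam_semiconjBy hkr (shift_mem_parabolic (-1) hx)
  rw [shift_shift_neg] at h
  exact h.eq.symm

theorem gen_dvd_Lam (a : Gen e r) : gen a ∣ Lam e r a.pos := by
  rcases a.two_le_pos.eq_or_lt with h | h
  · rw [← h, Lam_two h.symm]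
    exact dvd_mul_right _ _
  · obtain ⟨k, hk⟩ := Nat.exists_eq_add_of_le' (Nat.one_le_of_lt h)
    rw [hk, Lam_succ (by omega) hk, mul_assoc]
    exact dvd_mul_right _ _

theorem Lam_dvd_DeltaTo {k : ℕ} (hk : 2 ≤ k) (hkr : k ≤ r) : Lam e r k ∣ DeltaTo e r k := by
  obtain ⟨k, rfl⟩ := Nat.exists_eq_add_of_le' (Nat.one_le_of_lt hk)
  rw [DeltaTo_succ (by omega), mul_Lam_eq hkr (DeltaTo_mem_parabolic (by omega))]
  exact dvd_mul_right _ _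

theorem gen_dvd_DeltaTo {k : ℕ} (hkr : k ≤ r) {a : Gen e r} (ha : a.pos ≤ k) :
    gen a ∣ DeltaTo e r k := by
  induction k, ha using Nat.le_induction with
  | base => exact (gen_dvd_Lam a).trans (Lam_dvd_DeltaTo a.two_le_pos hkr)
  | succ k hak ih =>
    have := a.two_le_pos
    rw [DeltaTo_succ (by omega)]
    exact (ih (by omega)).trans (dvd_mul_right _ _)

theorem commute_gen_Lam_mul_Lam {k : ℕ} (hk : 2 ≤ k) (hkr : k + 1 ≤ r) {a : Gen e r}
    (ha : a.pos = k + 1) : Commute (gen a) (Lam e r k * Lam e r (k + 1)) := by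
  have hΛ : Lam e r (k + 1) * Lam e r k = Lam e r k * Lam e r (k + 1) := by
    rw [mul_Lam_eq hkr (Lam_mem_parabolic hk), shift_Lam _ hk]
  calc gen a * (Lam e r k * Lam e r (k + 1))
      = gen a * Lam e r k * gen a * (Lam e r k * gen a) := by
        rw [Lam_succ hk ha]; simp only [mul_assoc]
    _ = Lam e r k * Lam e r (k + 1) * gen a := by rw [← Lam_succ hk ha, ← mul_assoc, hΛ]

theorem DeltaTo_semiconjBy_gen {k : ℕ} (hk : 2 ≤ k) (hkr : k ≤ r) {a : Gen e r}
    (ha : a.pos ≤ k) : SemiconjBy (DeltaTo e r k) (gen a) (gen (a.shift k)) := by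
  induction k, hk using Nat.le_induction generalizing a with
  | base =>
    have ha2 : a.pos = 2 := ha.antisymm a.two_le_pos
    have hΔ (b : Gen e r) (hb : b.pos = 2) : DeltaTo e r 2 = gen b * gen b.pred := by
      rw [DeltaTo_two, Lam_two hb]
    have hshift : (a.shift 2).pred = a.shift 1 := by
      rw [← one_add_one_eq_two, ← Gen.shift_shift, Gen.pred_shift_one]
    rw [Nat.cast_ofNat]
    calc DeltaTo e r 2 * gen a
        = gen (a.shift 2) * gen (a.shift 1) * gen a := by rw [hΔ (a.shift 2) (by simpa), hshift]
      _ = gen (a.shift 2) * DeltaTo e r 2 := by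
        rw [mul_assoc, hΔ (a.shift 1) (by simpa), Gen.pred_shift_one]
  | succ k hk ih =>
    rw [DeltaTo_succ (by omega)]
    rcases ha.lt_or_eq with hlt | ha'
    · have h := (ih (by omega) (a := a.shift 1) (by rw [Gen.pos_shift]; omega)).mul_left
        (Lam_lcmSemiconjBy hkr hlt).semiconjBy
      rwa [Gen.shift_shift, add_comm (1 : ZMod e), ← Nat.cast_succ] at h
    · obtain ⟨l, rfl⟩ := Nat.exists_eq_add_of_le' (Nat.one_le_of_lt hk)
      rw [Gen.shift_eq_self _ (by omega), DeltaTo_succ (by omega), mul_assoc]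
      have hΔ : Commute (gen a) (DeltaTo e r l) :=
        commute_gen_of_mem_parabolic (by omega) (DeltaTo_mem_parabolic (by omega))
      exact (hΔ.mul_right (commute_gen_Lam_mul_Lam hk hkr ha')).symm

theorem Delta_semiconjBy (hr : 2 ≤ r) (x : BraidMonoid e r) :
    SemiconjBy (Delta e r) x (shift r x) := by
  induction x using induction_left with
  | one => simp only [map_one, SemiconjBy.one_right]
  | of_mul a x ih =>
    rw [map_mul]
    exact (DeltaTo_semiconjBy_gen hr le_rfl (a.pos_le hr)).mul_right ih

theorem gen_dvd_Delta (hr : 2 ≤ r) (a : Gen e r) : gen a ∣ Delta e r :=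
  gen_dvd_DeltaTo le_rfl (a.pos_le hr)

theorem isRightCancelMul (hr : 2 ≤ r) : IsRightCancelMul (BraidMonoid e r) :=
  isRightCancelMul_of_semiconjBy (d := Delta e r) (shift (r : ZMod e)) (shift_surjective _)
    (Delta_semiconjBy hr) (PresentedMonoid.closure_range_of (Rel e r))
    (by rintro _ ⟨a, rfl⟩; exact gen_dvd_Delta hr a)

theorem mul_gen_eq_of_semiconjBy {k : ℕ} (hkr : k + 1 ≤ r) {a b : Gen e r} (hbk : b.pos ≤ k)
    {p q : BraidMonoid e r} (hpq : Lam e r (k + 1) = p * q) (h : SemiconjBy q (gen b) (gen a)) :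
    p * gen a = gen (b.shift 1) * p := by
  have : IsRightCancelMul (BraidMonoid e r) := isRightCancelMul (by linarith [b.two_le_pos])
  refine mul_right_cancel (b := q) ?_
  rw [mul_assoc, ← h.eq, ← mul_assoc, mul_assoc (gen _), ← hpq]
  exact (Lam_lcmSemiconjBy hkr (Nat.lt_succ_of_le hbk)).semiconjBy

theorem DeltaTo_succ_eq {k : ℕ} (hk : 1 ≤ k) (hkr : k + 1 ≤ r) {P Q p q : BraidMonoid e r}
    (hPQ : DeltaTo e r k = P * Q) (hpq : Lam e r (k + 1) = p * q) :
    DeltaTo e r (k + 1) = P * p * (q * shift (-1) Q) := by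
  have hQ : Q ∈ parabolic e r k := (mul_mem_parabolic.1 (hPQ ▸ DeltaTo_mem_parabolic hk)).2
  rw [DeltaTo_succ hk, hPQ, mul_assoc, mul_Lam_eq hkr hQ, hpq]
  simp only [mul_assoc]

theorem exists_isLamSuffix_of_dvd_DeltaTo [Nontrivial (ZMod e)] {k : ℕ} (hk : 1 ≤ k)
    (hkr : k + 1 ≤ r) {x : BraidMonoid e r} (hx : x ∣ DeltaTo e r (k + 1)) :
    ∃ P p q, x = P * p ∧ P ∣ DeltaTo e r k ∧ Lam e r (k + 1) = p * q ∧
      IsLamSuffix (k + 1) q := by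
  induction x using induction_right with
  | one =>
    refine ⟨1, 1, Lam e r (k + 1), (one_mul 1).symm, one_dvd _, (one_mul _).symm, ?_⟩
    simpa only [tail_self, mul_one] using
      IsLamSuffix.Lam_mul_tail (e := e) (r := r) (k + 1) (by omega) le_rfl
  | mul_of x a ih =>
    obtain ⟨P, p, q, rfl, ⟨Q, hQ⟩, hpq, hq⟩ := ih ((dvd_mul_right _ _).trans hx)
    have hQk : Q ∈ parabolic e r k := (mul_mem_parabolic.1 (hQ ▸ DeltaTo_mem_parabolic hk)).2
    have hak : a.pos ≤ k + 1 := by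
      obtain ⟨w, hw⟩ := hx
      have := hw ▸ DeltaTo_mem_parabolic (e := e) (r := r) (Nat.le_add_left 1 k)
      exact gen_mem_parabolic.1 (mul_mem_parabolic.1 (mul_mem_parabolic.1 this).1).2
    have haq : gen a ∣ q * shift (-1) Q := by
      rw [DeltaTo_succ_eq hk hkr hQ hpq] at hx
      exact (mul_dvd_mul_left_cancel_iff _).1 hx
    cases hq.slideCase (by omega) hkr hak with
    | strip q' hq' =>
      exact ⟨P, p * gen a, q', mul_assoc _ _ _, ⟨Q, hQ⟩, by rw [hpq, mul_assoc], hq'⟩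
    | slide _ b hb =>
      obtain ⟨z, hz⟩ := hb.dvd_of_dvd_mul haq
      have hzk : gen b * z ∈ parabolic e r k := hz ▸ shift_mem_parabolic (-1) hQk
      have hbk : b.pos ≤ k := gen_mem_parabolic.1 (mul_mem_parabolic.1 hzk).1
      have hpa : p * gen a = gen (b.shift 1) * p :=
        mul_gen_eq_of_semiconjBy hkr hbk hpq hb.semiconjBy
      refine ⟨P * gen (b.shift 1), p, q, by rw [mul_assoc, hpa, mul_assoc], ?_, hpq, hq⟩
      rw [hQ, ← shift_shift_neg 1 Q, hz, map_mul, shift_gen, ← mul_assoc]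
      exact dvd_mul_right _ _
    | avoid _ h => exact absurd haq (h _ (shift_mem_parabolic _ hQk))

theorem prodTo_dvd_DeltaTo {k : ℕ} (hk : 1 ≤ k) (hkr : k ≤ r) {p : ℕ → BraidMonoid e r}
    (hp : ∀ j, 2 ≤ j → j ≤ k → p j ∣ Lam e r j) : prodTo k p ∣ DeltaTo e r k := by
  induction k, hk using Nat.le_induction with
  | base => exact dvd_rfl
  | succ k hk ih =>
    obtain ⟨Q, hQ⟩ := ih (by omega) fun j hj hjk => hp j hj (by omega)
    obtain ⟨q, hq⟩ := hp (k + 1) (by omega) le_rfl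
    rw [prodTo_succ hk, DeltaTo_succ_eq hk hkr hQ hq]
    exact dvd_mul_right _ _

theorem exists_prodTo_of_dvd_DeltaTo [Nontrivial (ZMod e)] {k : ℕ} (hk : 1 ≤ k) (hkr : k ≤ r)
    {x : BraidMonoid e r} (hx : x ∣ DeltaTo e r k) :
    ∃ p : ℕ → BraidMonoid e r, (∀ j, 2 ≤ j → j ≤ k → p j ∣ Lam e r j) ∧ x = prodTo k p := by
  induction k, hk using Nat.le_induction generalizing x with
  | base =>
    obtain ⟨y, hy⟩ := hx
    have hlen := congrArg len hy
    rw [DeltaTo_one, len_one, len_mul] at hlen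
    exact ⟨1, fun j hj hj1 => by omega, eq_one_of_len_eq_zero (by omega)⟩
  | succ k hk ih =>
    obtain ⟨P, p, q, rfl, hP, hpq, -⟩ := exists_isLamSuffix_of_dvd_DeltaTo hk hkr hx
    obtain ⟨f, hf, rfl⟩ := ih (by omega) hP
    refine ⟨Function.update f (k + 1) p, fun j hj hjk => ?_, ?_⟩
    · rcases hjk.lt_or_eq with hlt | rfl
      · rw [Function.update_of_ne hlt.ne]
        exact hf j hj (Nat.le_of_lt_succ hlt)
      · rw [Function.update_self, hpq]
        exact dvd_mul_right _ _
    · rw [prodTo_succ hk, Function.update_self]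
      congr 1
      exact prodTo_congr fun j _ hj => (Function.update_of_ne (by omega) _ _).symm

theorem dvd_DeltaTo_iff [Nontrivial (ZMod e)] {k : ℕ} (hk : 1 ≤ k) (hkr : k ≤ r)
    {x : BraidMonoid e r} : x ∣ DeltaTo e r k ↔
      ∃ p : ℕ → BraidMonoid e r, (∀ j, 2 ≤ j → j ≤ k → p j ∣ Lam e r j) ∧ x = prodTo k p :=
  ⟨exists_prodTo_of_dvd_DeltaTo hk hkr, fun ⟨_, hp, hx⟩ => hx ▸ prodTo_dvd_DeltaTo hk hkr hp⟩

/-! ### The minimal Garside element -/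

theorem DeltaTo_dvd [Nontrivial (ZMod e)] {k : ℕ} (hk : 2 ≤ k) (hkr : k ≤ r)
    {d : BraidMonoid e r} (hd : ∀ a : Gen e r, a.pos ≤ k → gen a ∣ d) : DeltaTo e r k ∣ d := by
  induction k, hk using Nat.le_induction with
  | base =>
    obtain ⟨u, rfl⟩ := hd (.t 0) le_rfl
    obtain ⟨v, rfl⟩ : gen (Gen.t 0).pred ∣ u :=
      gen_pred_dvd (a := .t 1) (by simp) rfl (hd (.t 1) le_rfl)
    rw [DeltaTo_two, Lam_two (a := .t 0) rfl, ← mul_assoc]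
    exact dvd_mul_right _ _
  | succ k hk ih =>
    obtain ⟨u, rfl⟩ := ih (by omega) fun a ha => hd a (ha.trans k.le_succ)
    obtain ⟨a, ha⟩ := Gen.exists_pos_eq (e := e) (r := r) (j := k + 1) (by omega) hkr
    have h := hd a ha.le
    obtain ⟨l, rfl⟩ := Nat.exists_eq_add_of_le' (Nat.one_le_of_lt hk)
    have hΔ : LcmSemiconjBy (DeltaTo e r l) (gen a) (gen a) :=
      lcmSemiconjBy_gen_of_mem_parabolic (by omega) (DeltaTo_mem_parabolic (by omega))
    rw [DeltaTo_succ (by omega), mul_assoc] at h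
    rw [DeltaTo_succ (by omega)]
    exact mul_dvd_mul_left _ (Lam_dvd_of_gen_dvd hk ha (hΔ.dvd_of_dvd_mul h))

instance [NeZero e] : Finite (Gen e r) := by
  let f : Gen e r → ZMod e ⊕ Fin (r + 1)
    | .t i => .inl i
    | .s j h => .inr ⟨j, Nat.lt_succ_of_le h.2⟩
  refine Finite.of_injective f ?_
  rintro (i | ⟨i, hi⟩) (j | ⟨j, hj⟩) h <;> simp_all [f]

theorem isGarsideElement_Delta [NeZero e] (hr : 2 ≤ r) : IsGarsideElement (Delta e r) := by
  have : IsRightCancelMul (BraidMonoid e r) := isRightCancelMul hr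
  have : IsCancelMul (BraidMonoid e r) := {}
  refine ⟨dvd_iff_exists_eq_mul_of_semiconjBy (shift (r : ZMod e)) (shift_surjective _)
      (Delta_semiconjBy hr),
    finite_dvd _, top_le_iff.1 ?_⟩
  rw [← PresentedMonoid.closure_range_of (Rel e r), Submonoid.closure_le]
  rintro _ ⟨a, rfl⟩
  exact Submonoid.subset_closure (gen_dvd_Delta hr a)

theorem isMinimalGarsideElement_Delta [NeZero e] [Nontrivial (ZMod e)] (hr : 2 ≤ r) :
    IsMinimalGarsideElement (Delta e r) :=
  ⟨isGarsideElement_Delta hr, fun _ hd =>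
    DeltaTo_dvd hr le_rfl fun a _ => of_mem_of_closure_eq_top hd.2.2 a⟩

end BraidMonoid

theorem theorem3p7 (e r : ℕ) (he : 2 ≤ e) (hr : 2 ≤ r) :
    IsMinimalGarsideElement (BraidMonoid.Delta e r) ∧
    ∀ x : BraidMonoid e r, IsSimpleElement x ↔
      ∃ p : ℕ → BraidMonoid e r,
        (∀ k : ℕ, 2 ≤ k → k ≤ r → p k ∣ BraidMonoid.Lam e r k) ∧
        x = BraidMonoid.orderedProd r p := by
  have : NeZero e := ⟨(zero_lt_two.trans_le he).ne'⟩
  have : Fact (1 < e) := ⟨he⟩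
  have hΔ : IsMinimalGarsideElement (BraidMonoid.Delta e r) :=
    BraidMonoid.isMinimalGarsideElement_Delta hr
  exact ⟨hΔ, fun x => (hΔ.isSimpleElement_iff x).trans
    (BraidMonoid.dvd_DeltaTo_iff (one_le_two.trans hr) le_rfl)⟩
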